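/- Let $N\ge 1$, $Q=(0,1)^N$, and let $r>0$, written as $r=k+s$ with $k=\lfloor r\rfloor$ and $s\in[0,1)$. Definitions. For $0<s<1$ and a smooth compactly supported function $f$ on $Q$, let $\partial_{i,R}^s f$ be the right-sided Riemann--Liouville derivative in the variable $x_i$, i.e. on each line parallel to the $x_i$-axis the operator $$d_R^s w(x)=-\frac1{\Gamma(1-s)}\frac{d}{dx}\int_x^1\frac{w(t)}{(t-x)^s}\,dt ,\qquad x\in(0,1),$$ and for a vector field $F=(F_1,\dots,F_N)$ put $\operatorname{div}^sF=\big[(1-\tfrac1N)s+\tfrac1N\big]\sum_{i=1}^N\partial^s_{i,R}F_i$. For a field of tensors of order $k$ put $\operatorname{div}^k\varphi=\sum_{j_1,\dots,j_k}\partial_{j_1}\cdots\partial_{j_k}\varphi_{j_1\dots j_k}$; for an array $\varphi=(\varphi_{i,j_1\dots j_k})$ the divergence $\operatorname{div}^k$ acts on the indices $j_1,\dots,j_k$ and gives a vector field. For $p\in[1,\infty]$ let $|\cdot|_{\ell^p}^*$ be the norm dual to the $\ell^p$ norm (all entries of an array are counted as coordinates). For $u\in L^1(Q)$ the total variation of order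 $r=k+s\ge 0$ is $$TV^{r}_{\ell^p}(u)=\sup\Big\{\int_Q u\,\operatorname{div}^s[\operatorname{div}^k\varphi]\,dx:\ \varphi\in C_c^\infty(Q;\mathbb R^{N\times N^k}),\ |\varphi|^*_{\ell^p}\le 1\Big\}\in[0,\infty]\qquad\text{if } 0<s<1,$$ $$TV^{k}_{\ell^p}(u)=\sup\Big\{\int_Q u\,\operatorname{div}^k\varphi\,dx:\ \varphi\in C_c^\infty(Q;\mathbb R^{N^k}),\ |\varphi|^*_{\ell^p}\le 1\Big\}\in[0,\infty]\qquad\text{if } s=0,$$ so that $TV^0_{\ell^p}(u)=\|u\|_{L^1(Q)}$. Let $SV^r(Q)$ be the set of all $u\in L^1(Q)$ such that for every $p\in[1,\infty]$ one has $TV^r_{\ell^p}(u)<\infty$ and there is a sequence $(u_n)\subset C^\infty(Q)\cap L^1(Q)$ with $TV^r_{\ell^p}(u_n)<\infty$ for all $n$, $u_n\to u$ in $L^1(Q)$ and $TV^r_{\ell^p}(u_n)\to TV^r_{\ell^p}(u)$. Theorem. There is a constant $C_r>0$, depending only on $r$ and $N$, such that for every $p\in[1,\infty]$ and every $u\in SV^r(Q)$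 $$TV^{s}_{\ell^p}(u)\le C_r\big(\|u\|_{L^1(Q)}+TV^r_{\ell^p}(u)\big).$$ -/

import Mathlib

open MeasureTheory Filter Topology
open scoped ENNReal ContDiff

noncomputable section

namespace FracTV

/-- The open unit cube `(0,1)^N`. -/
def cube (N : ℕ) : Set (Fin N → ℝ) := Set.univ.pi fun _ => Set.Ioo (0 : ℝ) 1

/-- The right-sided Riemann-Liouville derivative of order `s ∈ [0,1)` on the unit interval,
`-(1/Γ(1-s)) d/dx ∫_x^1 w(t) (t-x)^{-s} dt`. -/
def rightRL (s : ℝ) (w : ℝ → ℝ) (x : ℝ) : ℝ :=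
  -(1 / Real.Gamma (1 - s)) * deriv (fun y => ∫ t in y..1, w t / (t - y) ^ s) x

/-- The right-sided partial derivative of order `s` in the `i`-th variable. -/
def partialRL {N : ℕ} (s : ℝ) (i : Fin N) (f : (Fin N → ℝ) → ℝ) (x : Fin N → ℝ) : ℝ :=
  rightRL s (fun t => f (Function.update x i t)) (x i)

/-- The `k`-fold divergence of a field of tensors of order `k`; each step contracts the last
index, so the result is `∑_{j₁,…,j_k} ∂_{j₁} ⋯ ∂_{j_k} φ_{j₁ … j_k}`. -/
def iterDiv {N : ℕ} : (k : ℕ) → ((Fin k → Fin N) → (Fin N → ℝ) → ℝ) → (Fin N → ℝ) → ℝ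
  | 0, φ => φ fun i => i.elim0
  | k + 1, φ => iterDiv k fun a x =>
      ∑ j : Fin N, fderiv ℝ (φ (Fin.snoc (α := fun _ => Fin N) a j)) x (Pi.single j 1)

/-- The fractional divergence of order `s` of a vector field, with its normalizing factor. -/
def fracDiv {N : ℕ} (s : ℝ) (F : Fin N → (Fin N → ℝ) → ℝ) (x : Fin N → ℝ) : ℝ :=
  ((1 - 1 / (N : ℝ)) * s + 1 / (N : ℝ)) * ∑ i : Fin N, partialRL s i (F i) x

/-- The norm dual to the `ℓ^p` norm on `ℝ^ι`. -/
def dualNorm {ι : Type} [Fintype ι] (p : ℝ≥0∞) (a : ι → ℝ) : ℝ :=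
  sSup {t : ℝ | ∃ y : PiLp p (fun _ : ι => ℝ), ‖y‖ ≤ 1 ∧ t = ∑ i, a i * y i}

/-- Fields `φ ∈ C_c^∞(Q; ℝ^ι)` with `|φ|^*_{ℓ^p} ≤ 1` everywhere. -/
def IsTest {N : ℕ} {ι : Type} [Fintype ι] (p : ℝ≥0∞) (φ : ι → (Fin N → ℝ) → ℝ) : Prop :=
  (∀ i, ContDiff ℝ ∞ (φ i) ∧ HasCompactSupport (φ i) ∧ tsupport (φ i) ⊆ cube N) ∧
    ∀ x, dualNorm p (fun i => φ i x) ≤ 1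

/-- Total variation of integer order `k`. For `k = 0` the field `φ` is scalar and the value is
the `L^1` norm. The zero field is admissible, so the supremum is that of the real numbers
`∫_Q u div^k φ`. -/
def intTV {N : ℕ} (p : ℝ≥0∞) (k : ℕ) (u : (Fin N → ℝ) → ℝ) : ℝ≥0∞ :=
  ⨆ (φ : (Fin k → Fin N) → (Fin N → ℝ) → ℝ) (_ : IsTest p φ),
    ENNReal.ofReal (∫ x in cube N, u x * iterDiv k φ x)

/-- Total variation of order `k + s`, `0 < s < 1`; the field takes values in `N × N^k` arrays. -/
def fracTV {N : ℕ} (p : ℝ≥0∞) (k : ℕ) (s : ℝ) (u : (Fin N → ℝ) → ℝ) : ℝ≥0∞ :=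
  ⨆ (φ : Fin N × (Fin k → Fin N) → (Fin N → ℝ) → ℝ) (_ : IsTest p φ),
    ENNReal.ofReal
      (∫ x in cube N, u x * fracDiv s (fun i => iterDiv k fun a => φ (i, a)) x)

open Classical in
/-- The total variation of order `r ≥ 0` with underlying `ℓ^p` norm. -/
def TV {N : ℕ} (p : ℝ≥0∞) (r : ℝ) (u : (Fin N → ℝ) → ℝ) : ℝ≥0∞ :=
  if Int.fract r = 0 then intTV p ⌊r⌋₊ u else fracTV p ⌊r⌋₊ (Int.fract r) u

/-- The norm of `L^1(Q)`. -/
def normL1 {N : ℕ} (u : (Fin N → ℝ) → ℝ) : ℝ≥0∞ := ∫⁻ x in cube N, ‖u x‖ₑ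

/-- Strict convergence `v n → u` with respect to the total variation of order `r` with
underlying `ℓ^p` norm. All the total variations involved are finite. -/
structure StrictConv {N : ℕ} (p : ℝ≥0∞) (r : ℝ) (v : ℕ → (Fin N → ℝ) → ℝ)
    (u : (Fin N → ℝ) → ℝ) : Prop where
  integrable_seq : ∀ n, IntegrableOn (v n) (cube N)
  finite_seq : ∀ n, TV p r (v n) < ⊤
  integrable_lim : IntegrableOn u (cube N)
  finite_lim : TV p r u < ⊤
  tendsto_L1 : Tendsto (fun n => normL1 (fun x => u x - v n x)) atTop (𝓝 0)
  tendsto_TV : Tendsto (fun n => TV p r (v n)) atTop (𝓝 (TV p r u))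

/-- The space `SV^r(Q)`: functions which for every `p ∈ [1,∞]` are strict limits of functions
that are smooth in the open cube. -/
def SV (N : ℕ) (r : ℝ) : Set ((Fin N → ℝ) → ℝ) :=
  {u | ∀ p : ℝ≥0∞, 1 ≤ p → ∃ v : ℕ → (Fin N → ℝ) → ℝ,
    (∀ n, ContDiffOn ℝ ∞ (v n) (cube N)) ∧ StrictConv p r v u}

end FracTV

end

/-! By duality the bound concerns test fields. For φ admissible at order s, div^s φ is rewritten as
a multiple of div^s div^k Ψ, with Ψ admissible at order r, plus a bounded function, whose pairing
with u costs only a multiple of the L^1 norm.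

Each component is split on its own as φ_i = ∂_i^k g_i + R_i, with g_i and ∂_i R_i bounded in terms
of k alone (`exists_bound_eq_iterate_pderiv_add`). The splitting integrates along lines in direction
i: a test function has a compactly supported primitive once its integral over each line is cancelled
by a multiple of a fixed bump in x_i, and further ∂_i-derivatives of this correction fall on the
bump only.

Placing g_i in the entry (i; i,…,i) of Ψ turns div^k into ∂_i^k (`iterDiv_ite_const`). Since s < 1,
the derivative of order s of R_i is an integral of ∂_i R_i against an integrable kernel, hence
bounded (`abs_caputo_le`). The constants do not depend on p because every dual norm lies between the
ℓ^∞ and ℓ^1 norms. -/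

noncomputable section

namespace FracTV

/-! ### Test functions on the cube and their partial derivatives -/

variable {N : ℕ}

/-- The `i`-th partial derivative. -/
def pderiv (i : Fin N) (f : (Fin N → ℝ) → ℝ) (x : Fin N → ℝ) : ℝ :=
  fderiv ℝ f x (Pi.single i 1)

/-- Scalar test functions: smooth with compact support in the open cube. -/
structure IsTestFun (f : (Fin N → ℝ) → ℝ) : Prop where
  contDiff : ContDiff ℝ ∞ f
  hasCompactSupport : HasCompactSupport f
  tsupport_subset : tsupport f ⊆ cube N

/-- A closed δ-thickening of the support still lies in the cube, so a support point can be moved by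
±δ in one coordinate without leaving (0,1). This coordinatewise form suits arguments on lines. -/
theorem IsTestFun.exists_margin {f : (Fin N → ℝ) → ℝ} (hf : IsTestFun f) :
    ∃ ε > 0, ∀ x j, x j ∉ Set.Icc ε (1 - ε) → f x = 0 := by
  obtain ⟨δ, hδ, h⟩ := hf.hasCompactSupport.isCompact.exists_cthickening_subset_open
    (isOpen_set_pi Set.finite_univ fun _ _ => isOpen_Ioo) hf.tsupport_subset
  refine ⟨δ, hδ, fun x j hj => ?_⟩
  by_contra hx
  have hxt : x ∈ tsupport f := subset_tsupport f hx
  have key : ∀ t : ℝ, |t| ≤ δ → x j + t ∈ Set.Ioo (0 : ℝ) 1 := by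
    intro t ht
    have h1 : Function.update x j (x j + t) ∈ Metric.cthickening δ (tsupport f) := by
      refine Metric.mem_cthickening_of_dist_le _ x _ _ hxt ?_
      refine (dist_pi_le_iff hδ.le).2 fun l => ?_
      by_cases hl : l = j
      · subst hl; simpa using ht
      · simp [Function.update_of_ne hl, hδ.le]
    simpa using h h1 j (Set.mem_univ j)
  apply hj
  have h1 := (key (-δ) (by simp [abs_of_pos hδ])).1
  have h2 := (key δ (by simp [abs_of_pos hδ])).2
  constructor <;> linarith

theorem IsTestFun.of_margin {f : (Fin N → ℝ) → ℝ} (hf : ContDiff ℝ ∞ f) {ε : ℝ} (hε : 0 < ε)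
    (h : ∀ x j, x j ∉ Set.Icc ε (1 - ε) → f x = 0) : IsTestFun f := by
  have hK : IsCompact (Set.univ.pi fun _ : Fin N => Set.Icc ε (1 - ε)) :=
    isCompact_univ_pi fun _ => isCompact_Icc
  have hsub : tsupport f ⊆ Set.univ.pi fun _ : Fin N => Set.Icc ε (1 - ε) := by
    refine closure_minimal (fun x hx j _ => ?_) hK.isClosed
    by_contra hj
    exact hx (h x j hj)
  refine ⟨hf, hK.of_isClosed_subset (isClosed_tsupport f) hsub, hsub.trans ?_⟩
  exact Set.pi_mono fun _ _ => Set.Icc_subset_Ioo hε (by linarith)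

theorem IsTestFun.zero : IsTestFun (fun _ : Fin N → ℝ => (0 : ℝ)) :=
  .of_margin contDiff_const one_pos fun _ _ _ => rfl

theorem IsTestFun.add {f g : (Fin N → ℝ) → ℝ} (hf : IsTestFun f) (hg : IsTestFun g) :
    IsTestFun fun x => f x + g x := by
  refine ⟨hf.contDiff.add hg.contDiff, hf.hasCompactSupport.add hg.hasCompactSupport, ?_⟩
  exact (tsupport_add f g).trans (Set.union_subset hf.tsupport_subset hg.tsupport_subset)

theorem IsTestFun.const_mul {f : (Fin N → ℝ) → ℝ} (hf : IsTestFun f) (c : ℝ) :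
    IsTestFun fun x => c * f x := by
  refine ⟨contDiff_const.mul hf.contDiff, hf.hasCompactSupport.mul_left, ?_⟩
  exact (tsupport_mul_subset_right (f := fun _ => c)).trans hf.tsupport_subset

theorem IsTestFun.pderiv {f : (Fin N → ℝ) → ℝ} (hf : IsTestFun f) (i : Fin N) :
    IsTestFun (pderiv i f) := by
  refine ⟨?_, hf.hasCompactSupport.fderiv_apply ℝ _, ?_⟩
  · exact (hf.contDiff.fderiv_right (m := ∞) (by simp)).clm_apply contDiff_const
  · exact (tsupport_fderiv_apply_subset ℝ _).trans hf.tsupport_subset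

theorem IsTestFun.exists_bound {f : (Fin N → ℝ) → ℝ} (hf : IsTestFun f) :
    ∃ M, 0 ≤ M ∧ ∀ x, |f x| ≤ M := by
  obtain ⟨M, hM⟩ := hf.hasCompactSupport.exists_bound_of_continuous hf.contDiff.continuous
  exact ⟨M, (norm_nonneg _).trans (hM 0), hM⟩

theorem IsTestFun.differentiable {f : (Fin N → ℝ) → ℝ} (hf : IsTestFun f) :
    Differentiable ℝ f := hf.contDiff.differentiable (by simp)

theorem pderiv_add {f g : (Fin N → ℝ) → ℝ} (hf : IsTestFun f) (hg : IsTestFun g) (i : Fin N) :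
    pderiv i (fun x => f x + g x) = fun x => pderiv i f x + pderiv i g x := by
  ext x
  simp [pderiv, fderiv_fun_add (hf.differentiable x) (hg.differentiable x)]

theorem pderiv_const_mul {f : (Fin N → ℝ) → ℝ} (hf : IsTestFun f) (c : ℝ) (i : Fin N) :
    pderiv i (fun x => c * f x) = fun x => c * pderiv i f x := by
  ext x
  simp [pderiv, fderiv_const_mul (hf.differentiable x)]

theorem hasDerivAt_comp_update {f : (Fin N → ℝ) → ℝ} (hf : Differentiable ℝ f) (i : Fin N)
    (x : Fin N → ℝ) (t : ℝ) :
    HasDerivAt (fun t => f (Function.update x i t)) (pderiv i f (Function.update x i t)) t :=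
  (hf _).hasFDerivAt.comp_hasDerivAt t (hasDerivAt_update x i t)

theorem pderiv_eq_of_hasDerivAt {f : (Fin N → ℝ) → ℝ} (hf : Differentiable ℝ f) {i : Fin N}
    {x : Fin N → ℝ} {d : ℝ} (h : HasDerivAt (fun t => f (Function.update x i t)) d (x i)) :
    pderiv i f x = d := by
  simpa using (hasDerivAt_comp_update hf i x (x i)).unique h

theorem contDiff_update (i : Fin N) :
    ContDiff ℝ ∞ fun q : (Fin N → ℝ) × ℝ => Function.update q.1 i q.2 := by
  refine contDiff_pi.2 fun j => ?_
  by_cases hj : j = i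
  · subst hj; simpa using contDiff_snd
  · simp only [Function.update_of_ne hj]
    exact (contDiff_apply ℝ ℝ j).comp contDiff_fst

/-! ### Primitives in one variable -/

/-- The primitive in the `i`-th variable which vanishes at `-∞`. -/
def primitive (i : Fin N) (h : (Fin N → ℝ) → ℝ) (x : Fin N → ℝ) : ℝ :=
  ∫ t in Set.Iic (x i), h (Function.update x i t)

/-- The integral over lines parallel to the `i`-th axis. -/
def lineIntegral (i : Fin N) (h : (Fin N → ℝ) → ℝ) (x : Fin N → ℝ) : ℝ :=
  ∫ t, h (Function.update x i t)

/-- A convolution in one variable, the others being parameters, is as smooth as its smooth factor.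
Taking f = 1 yields line integrals, and the indicator of [0,∞) yields primitives. -/
theorem contDiff_integral_update {h : (Fin N → ℝ) → ℝ} (hh : IsTestFun h) (i : Fin N)
    {f : ℝ → ℝ} (hf : LocallyIntegrable f) :
    ContDiff ℝ ∞ fun x : Fin N → ℝ => ∫ t, f t * h (Function.update x i (x i - t)) := by
  obtain ⟨ε, hε, hs⟩ := hh.exists_margin
  have key := contDiffOn_convolution_right_with_param (𝕜 := ℝ) (μ := volume) (n := ⊤) (f := f)
    (ContinuousLinearMap.mul ℝ ℝ) (g := fun (x : Fin N → ℝ) t => h (Function.update x i t))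
    (s := Set.univ) (k := Set.Icc ε (1 - ε)) isOpen_univ isCompact_Icc
    (fun x t _ ht => hs _ i (by simpa using ht)) hf
    (hh.contDiff.comp (contDiff_update i)).contDiffOn
  rw [Set.univ_prod_univ, contDiffOn_univ] at key
  exact key.comp (contDiff_id.prodMk (contDiff_apply ℝ ℝ i))

theorem contDiff_lineIntegral {h : (Fin N → ℝ) → ℝ} (hh : IsTestFun h) (i : Fin N) :
    ContDiff ℝ ∞ (lineIntegral i h) := by
  have := contDiff_integral_update hh i (f := fun _ => 1) (locallyIntegrable_const 1)
  convert this using 2 with x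
  simp only [one_mul, lineIntegral]
  exact (integral_sub_left_eq_self (fun t => h (Function.update x i t)) volume (x i)).symm

theorem contDiff_primitive {h : (Fin N → ℝ) → ℝ} (hh : IsTestFun h) (i : Fin N) :
    ContDiff ℝ ∞ (primitive i h) := by
  have := contDiff_integral_update hh i (f := (Set.Ici 0).indicator fun _ => 1)
    ((locallyIntegrable_const 1).indicator measurableSet_Ici)
  convert this using 2 with x
  rw [← integral_sub_left_eq_self _ volume (x i), primitive,
    ← integral_indicator measurableSet_Iic]
  refine integral_congr_ae (.of_forall fun t => ?_)
  by_cases ht : t ≤ x i <;> simp [Set.indicator, ht]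

theorem IsTestFun.integrable_line {h : (Fin N → ℝ) → ℝ} (hh : IsTestFun h) (i : Fin N)
    (x : Fin N → ℝ) : Integrable fun t => h (Function.update x i t) := by
  obtain ⟨ε, hε, hs⟩ := hh.exists_margin
  refine Continuous.integrable_of_hasCompactSupport
    (hh.contDiff.continuous.comp (continuous_const.update i continuous_id)) ?_
  exact HasCompactSupport.intro (isCompact_Icc (a := ε) (b := 1 - ε))
    fun t ht => hs _ i (by simpa using ht)

theorem pderiv_primitive {h : (Fin N → ℝ) → ℝ} (hh : IsTestFun h) (i : Fin N) :
    pderiv i (primitive i h) = h := by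
  ext x
  refine pderiv_eq_of_hasDerivAt ((contDiff_primitive hh i).differentiable (by simp)) ?_
  have hc : Continuous fun t => h (Function.update x i t) :=
    hh.contDiff.continuous.comp (continuous_const.update i continuous_id)
  have hd := (hc.integral_hasStrictDerivAt 0 (x i)).hasDerivAt.const_add
    (∫ t in Set.Iic 0, h (Function.update x i t))
  simp only [Function.update_eq_self] at hd
  refine hd.congr_of_eventuallyEq (.of_forall fun τ => ?_)
  have := intervalIntegral.integral_Iic_sub_Iic (hh.integrable_line i x).integrableOn
    (hh.integrable_line i x).integrableOn (a := 0) (b := τ)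
  simp only [primitive, Function.update_self, Function.update_idem]
  linarith

/-- Within the support a line has length at most 1. The set is arbitrary so that half-lines
(primitives) and whole lines are both covered. -/
theorem abs_setIntegral_line_le {h : (Fin N → ℝ) → ℝ} (hh : IsTestFun h) {M : ℝ}
    (hM : ∀ x, |h x| ≤ M) (i : Fin N) (x : Fin N → ℝ) (s : Set ℝ) :
    |∫ t in s, h (Function.update x i t)| ≤ M := by
  obtain ⟨ε, hε, hs⟩ := hh.exists_margin
  have h1 : ∫ t in s, ‖h (Function.update x i t)‖ ≤ ∫ t, ‖h (Function.update x i t)‖ :=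
    setIntegral_le_integral (hh.integrable_line i x).norm (.of_forall fun _ => norm_nonneg _)
  have h2 : ∫ t, ‖h (Function.update x i t)‖ = ∫ t in Set.Icc 0 1, ‖h (Function.update x i t)‖ := by
    refine (setIntegral_eq_integral_of_forall_compl_eq_zero fun t ht => ?_).symm
    rw [hs _ i, norm_zero]
    simp only [Function.update_self]
    exact fun h => ht ⟨hε.le.trans h.1, h.2.trans (by linarith)⟩
  have h3 : ∫ t in Set.Icc (0 : ℝ) 1, ‖h (Function.update x i t)‖ ≤ ∫ t in Set.Icc (0 : ℝ) 1, M :=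
    integral_mono (hh.integrable_line i x).norm.integrableOn (integrable_const _)
      fun t => hM _
  have h4 := norm_integral_le_integral_norm (μ := volume.restrict s)
    fun t => h (Function.update x i t)
  simp only [Real.norm_eq_abs] at *
  simp at h3
  linarith

/-- A function of zero mean on all lines parallel to the `i`-th axis has a primitive which is
again a test function. -/
theorem isTestFun_primitive {h : (Fin N → ℝ) → ℝ} (hh : IsTestFun h) (i : Fin N)
    (h0 : ∀ x, lineIntegral i h x = 0) : IsTestFun (primitive i h) := by
  obtain ⟨ε, hε, hs⟩ := hh.exists_margin
  refine .of_margin (contDiff_primitive hh i) hε fun x j hj => ?_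
  by_cases hji : j = i
  · subst hji
    rcases lt_or_ge (x j) ε with hlt | hge
    · refine setIntegral_eq_zero_of_forall_eq_zero fun t ht => hs _ j ?_
      simp only [Function.update_self]
      exact fun h => absurd (h.1.trans (Set.mem_Iic.1 ht)) (not_le.2 hlt)
    -- Past the support the primitive equals the full line integral, which is zero by assumption.
    · have hgt : 1 - ε < x j := not_le.1 fun h => hj ⟨hge, h⟩
      rw [← h0 x]
      refine setIntegral_eq_integral_of_forall_compl_eq_zero fun t ht => hs _ j ?_
      simp only [Function.update_self]
      exact fun h => ht (h.2.trans hgt.le)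
  · exact setIntegral_eq_zero_of_forall_eq_zero fun t _ =>
      hs _ j (by simpa [Function.update_of_ne hji] using hj)

/-! ### Splitting off iterated derivatives -/

/-- A smooth function on the line, with compact support in `(0,1)` and integral `1`. -/
theorem exists_unit_bump : ∃ η : ℝ → ℝ, ContDiff ℝ ∞ η ∧
    (∀ t ∉ Set.Icc (1 / 4 : ℝ) (1 - 1 / 4), η t = 0) ∧ ∫ t, η t = 1 := by
  let b : ContDiffBump (1 / 2 : ℝ) := ⟨1 / 8, 1 / 4, by norm_num, by norm_num⟩
  refine ⟨b.normed volume, b.contDiff_normed, fun t ht => ?_, b.integral_normed⟩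
  by_contra h
  have : t ∈ Function.support (b.normed volume) := h
  rw [b.support_normed_eq, Metric.mem_ball, Real.dist_eq, abs_lt] at this
  simp only [b] at this
  exact ht ⟨by linarith, by linarith⟩

theorem iteratedDeriv_eq_zero_of_notMem {η : ℝ → ℝ} {K : Set ℝ} (hK : IsClosed K)
    (h : ∀ t ∉ K, η t = 0) (k : ℕ) : ∀ t ∉ K, iteratedDeriv k η t = 0 := by
  intro t ht
  have : η =ᶠ[𝓝 t] fun _ => 0 := by
    filter_upwards [hK.isOpen_compl.mem_nhds ht] with y hy using h y hy
  rw [(this.iteratedDeriv k).eq_of_nhds]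
  simp

theorem exists_bound_iteratedDeriv {η : ℝ → ℝ} (hη : ContDiff ℝ ∞ η) {a b : ℝ}
    (h : ∀ t ∉ Set.Icc a b, η t = 0) (k : ℕ) :
    ∃ M, 0 ≤ M ∧ ∀ t, |iteratedDeriv k η t| ≤ M := by
  have hs : HasCompactSupport (iteratedDeriv k η) :=
    HasCompactSupport.intro (isCompact_Icc (a := a) (b := b))
      (iteratedDeriv_eq_zero_of_notMem isClosed_Icc h k)
  obtain ⟨M, hM⟩ := hs.exists_bound_of_continuous
    (hη.continuous_iteratedDeriv k (by exact_mod_cast le_top))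
  exact ⟨M, (norm_nonneg _).trans (hM 0), hM⟩

/-- Products of a line integral with a profile in the direction of the lines. -/
theorem IsTestFun.lineIntegral_mul {h : (Fin N → ℝ) → ℝ} (hh : IsTestFun h) (i : Fin N)
    {η : ℝ → ℝ} (hη : ContDiff ℝ ∞ η) {δ : ℝ} (hδ : 0 < δ)
    (hs : ∀ t ∉ Set.Icc δ (1 - δ), η t = 0) :
    IsTestFun fun x => lineIntegral i h x * η (x i) := by
  obtain ⟨ε, hε, hsupp⟩ := hh.exists_margin
  refine .of_margin ((contDiff_lineIntegral hh i).mul (hη.comp (contDiff_apply ℝ ℝ i)))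
    (lt_min hε hδ) fun x j hj => ?_
  by_cases hji : j = i
  · subst hji
    rw [hs, mul_zero]
    exact fun h => hj ⟨(min_le_right _ _).trans h.1, by linarith [h.2, min_le_right ε δ]⟩
  · have : lineIntegral i h x = 0 := by
      refine integral_eq_zero_of_ae (.of_forall fun t => hsupp _ j ?_)
      rw [Function.update_of_ne hji]
      exact fun h => hj ⟨(min_le_left _ _).trans h.1, by linarith [h.2, min_le_left ε δ]⟩
    rw [this, zero_mul]

theorem lineIntegral_update (i : Fin N) (h : (Fin N → ℝ) → ℝ) (x : Fin N → ℝ) (t : ℝ) :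
    lineIntegral i h (Function.update x i t) = lineIntegral i h x := by
  simp [lineIntegral]

theorem pderiv_lineIntegral_mul {h : (Fin N → ℝ) → ℝ} (hh : IsTestFun h) (i : Fin N)
    {η : ℝ → ℝ} (hη : Differentiable ℝ η) :
    pderiv i (fun x => lineIntegral i h x * η (x i)) =
      fun x => lineIntegral i h x * deriv η (x i) := by
  ext x
  have hd : Differentiable ℝ fun x => lineIntegral i h x * η (x i) :=
    ((contDiff_lineIntegral hh i).differentiable (by simp)).mul (hη.comp (differentiable_apply i))
  refine pderiv_eq_of_hasDerivAt hd ?_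
  simp only [lineIntegral_update, Function.update_self]
  exact (hη (x i)).hasDerivAt.const_mul _

theorem iterate_pderiv_lineIntegral_mul {h : (Fin N → ℝ) → ℝ} (hh : IsTestFun h) (i : Fin N)
    {η : ℝ → ℝ} (hη : ContDiff ℝ ∞ η) (k : ℕ) :
    (pderiv i)^[k] (fun x => lineIntegral i h x * η (x i)) =
      fun x => lineIntegral i h x * iteratedDeriv k η (x i) := by
  induction k with
  | zero => simp
  | succ k ih =>
    rw [Function.iterate_succ_apply', ih, pderiv_lineIntegral_mul hh i, iteratedDeriv_succ]
    exact hη.differentiable_iteratedDeriv k (by exact_mod_cast WithTop.coe_lt_top _)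

theorem IsTestFun.iterate_pderiv {f : (Fin N → ℝ) → ℝ} (hf : IsTestFun f) (i : Fin N) (k : ℕ) :
    IsTestFun ((FracTV.pderiv i)^[k] f) := by
  induction k with
  | zero => exact hf
  | succ k ih => rw [Function.iterate_succ_apply']; exact ih.pderiv i

theorem iterate_pderiv_add {f g : (Fin N → ℝ) → ℝ} (hf : IsTestFun f) (hg : IsTestFun g)
    (i : Fin N) (k : ℕ) :
    (pderiv i)^[k] (fun x => f x + g x) =
      fun x => (pderiv i)^[k] f x + (pderiv i)^[k] g x := by
  induction k with
  | zero => rfl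
  | succ k ih =>
    simp only [Function.iterate_succ_apply', ih]
    exact pderiv_add (hf.iterate_pderiv i k) (hg.iterate_pderiv i k) i

theorem iterate_pderiv_const_mul {f : (Fin N → ℝ) → ℝ} (hf : IsTestFun f) (c : ℝ)
    (i : Fin N) (k : ℕ) :
    (pderiv i)^[k] (fun x => c * f x) = fun x => c * (pderiv i)^[k] f x := by
  induction k with
  | zero => rfl
  | succ k ih =>
    simp only [Function.iterate_succ_apply', ih]
    exact pderiv_const_mul (hf.iterate_pderiv i k) c i

/-- A test function is the derivative of a test function up to its line integrals. -/
theorem IsTestFun.exists_eq_pderiv_add {f : (Fin N → ℝ) → ℝ} (hf : IsTestFun f) (i : Fin N)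
    {M : ℝ} (hM : ∀ x, |f x| ≤ M) {η : ℝ → ℝ} (hη : ContDiff ℝ ∞ η) {δ : ℝ} (hδ : 0 < δ)
    (hs : ∀ t ∉ Set.Icc δ (1 - δ), η t = 0) (hint : ∫ t, η t = 1) {B : ℝ}
    (hB : ∀ t, |η t| ≤ B) :
    ∃ g : (Fin N → ℝ) → ℝ, IsTestFun g ∧ (∀ x, |g x| ≤ M + M * B) ∧
      f = fun x => FracTV.pderiv i g x + lineIntegral i f x * η (x i) := by
  have hc := hf.lineIntegral_mul i hη hδ hs
  have hcM : ∀ x, |lineIntegral i f x| ≤ M := fun x => by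
    simpa [lineIntegral] using abs_setIntegral_line_le hf hM i x Set.univ
  have hM0 : 0 ≤ M := (abs_nonneg _).trans (hM 0)
  -- Since η has integral 1, this correction removes exactly the mean of f on each line.
  set h : (Fin N → ℝ) → ℝ := fun x => f x + -1 * (lineIntegral i f x * η (x i)) with hdef
  have hh : IsTestFun h := hf.add (hc.const_mul (-1))
  have hhM : ∀ x, |h x| ≤ M + M * B := fun x => by
    refine (abs_add_le _ _).trans (add_le_add (hM x) ?_)
    rw [neg_one_mul, abs_neg, abs_mul]
    exact mul_le_mul (hcM x) (hB _) (abs_nonneg _) hM0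
  have h0 : ∀ x, lineIntegral i h x = 0 := by
    intro x
    have h1 := integral_add (hf.integrable_line i x) ((hc.const_mul (-1)).integrable_line i x)
    have h2 : lineIntegral i h x = _ := h1
    rw [h2, integral_const_mul]
    simp only [lineIntegral_update, Function.update_self, integral_const_mul, hint]
    simp [lineIntegral]
  refine ⟨primitive i h, isTestFun_primitive hh i h0,
    fun x => abs_setIntegral_line_le hh hhM i x _, ?_⟩
  rw [pderiv_primitive hh i]
  ext x
  simp [hdef]

/-- Every test function bounded by `1` is a `k`-fold derivative of a bounded test function up to a
test function with bounded derivative, the bounds depending only on `k`. -/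
theorem exists_bound_eq_iterate_pderiv_add (k : ℕ) :
    ∃ C : ℝ, 0 < C ∧ ∀ (i : Fin N) (f : (Fin N → ℝ) → ℝ), IsTestFun f → (∀ x, |f x| ≤ 1) →
      ∃ g R : (Fin N → ℝ) → ℝ, IsTestFun g ∧ IsTestFun R ∧ (∀ x, |g x| ≤ C) ∧
        (∀ x, |pderiv i R x| ≤ C) ∧ f = fun x => (pderiv i)^[k] g x + R x := by
  obtain ⟨η, hη, hs, hint⟩ := exists_unit_bump
  obtain ⟨B, hB0, hB⟩ := exists_bound_iteratedDeriv hη hs 0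
  simp only [iteratedDeriv_zero] at hB
  induction k with
  | zero =>
    refine ⟨1, one_pos, fun i f hf h1 => ⟨f, fun _ => 0, hf, .zero, h1, fun x => ?_, by simp⟩⟩
    simp [pderiv]
  | succ k ih =>
    obtain ⟨C, hC, ih⟩ := ih
    obtain ⟨B', hB'0, hB'⟩ := exists_bound_iteratedDeriv hη hs (k + 1)
    refine ⟨C + C * B + C * B', by positivity, fun i f hf h1 => ?_⟩
    obtain ⟨g, R, hg, hR, hgC, hRC, rfl⟩ := ih i f hf h1
    obtain ⟨g', hg', hg'C, hgg'⟩ := hg.exists_eq_pderiv_add i hgC hη (by norm_num) hs hint hB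
    have hηk : ContDiff ℝ ∞ (iteratedDeriv k η) := by
      rw [iteratedDeriv_eq_iterate]; exact hη.iterate_deriv k
    have hT : IsTestFun fun x => lineIntegral i g x * iteratedDeriv k η (x i) :=
      hg.lineIntegral_mul i hηk (by norm_num) (iteratedDeriv_eq_zero_of_notMem isClosed_Icc hs k)
    have hCB : 0 ≤ C * B := by positivity
    have hCB' : 0 ≤ C * B' := by positivity
    -- Replacing g by ∂_i g' plus its correction adds to R the k-th derivative of that correction;
    -- one more ∂_i gives η^(k+1), whence the bound `B'`.
    refine ⟨g', fun x => R x + lineIntegral i g x * iteratedDeriv k η (x i), hg', hR.add hT,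
      fun x => (hg'C x).trans (by linarith), fun x => ?_, ?_⟩
    · rw [pderiv_add hR hT, pderiv_lineIntegral_mul hg i (hηk.differentiable (by simp)),
        ← iteratedDeriv_succ]
      have h2 : |lineIntegral i g x| ≤ C := by
        simpa [lineIntegral] using abs_setIntegral_line_le hg hgC i x Set.univ
      have h3 := mul_le_mul h2 (hB' (x i)) (abs_nonneg _) hC.le
      rw [← abs_mul] at h3
      linarith [(abs_add_le (pderiv i R x)
        (lineIntegral i g x * iteratedDeriv (k + 1) η (x i))), hRC x]
    · have h4 : (pderiv i)^[k] g = fun x => (pderiv i)^[k + 1] g' x +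
          lineIntegral i g x * iteratedDeriv k η (x i) := by
        conv_lhs => rw [hgg']
        rw [iterate_pderiv_add (hg'.pderiv i) (hg.lineIntegral_mul i hη (by norm_num) hs),
          iterate_pderiv_lineIntegral_mul hg i hη, Function.iterate_succ_apply]
      ext x
      rw [h4]
      ring

/-! ### The right-sided Riemann-Liouville derivative of test functions -/

theorem intervalIntegrable_div_rpow {s : ℝ} (hs : s < 1) {g : ℝ → ℝ} (hg : Continuous g)
    {b : ℝ} (hb : 0 ≤ b) : IntervalIntegrable (fun τ => g τ / τ ^ s) volume 0 b := by
  have h := (intervalIntegral.intervalIntegrable_rpow' (a := 0) (b := b) (r := -s)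
    (by linarith)).continuousOn_mul hg.continuousOn
  refine h.congr fun τ hτ => ?_
  rw [Set.uIoc_of_le hb] at hτ
  simp only [Real.rpow_neg hτ.1.le, div_eq_mul_inv]

/-- After the substitution t = y + τ the singularity no longer depends on y, and the vanishing of w
beyond 1 fixes the upper limit. Differentiation under the integral is then dominated by M/τ^s,
integrable for s < 1. -/
theorem rightRL_eq {s : ℝ} (hs : s < 1) {w w' : ℝ → ℝ} (hw : ∀ t, HasDerivAt w (w' t) t)
    (hw' : Continuous w') {M : ℝ} (hM : ∀ t, |w' t| ≤ M) (h1 : ∀ t, 1 ≤ t → w t = 0) {x : ℝ}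
    (hx : x ∈ Set.Ioo (0 : ℝ) 1) :
    rightRL s w x = -(1 / Real.Gamma (1 - s)) * ∫ τ in (0 : ℝ)..1, w' (x + τ) / τ ^ s := by
  have hwc : Continuous w := continuous_iff_continuousAt.2 fun t => (hw t).continuousAt
  have heq : (fun y => ∫ t in y..1, w t / (t - y) ^ s) =ᶠ[𝓝 x]
      fun y => ∫ τ in (0 : ℝ)..1, w (y + τ) / τ ^ s := by
    filter_upwards [isOpen_Ioo.mem_nhds hx] with y hy
    have hyc : Continuous fun τ => w (y + τ) := hwc.comp (continuous_const.add continuous_id)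
    have h2 := intervalIntegral.integral_comp_add_left (a := 0) (b := 1 - y)
      (fun t => w t / (t - y) ^ s) y
    simp only [add_sub_cancel_left, add_zero, add_sub_cancel] at h2
    have hi0 := intervalIntegrable_div_rpow hs hyc (b := 1 - y) (by linarith [hy.2])
    have hi1 := intervalIntegrable_div_rpow hs hyc zero_le_one
    have h3 := intervalIntegral.integral_add_adjacent_intervals hi0 (hi0.symm.trans hi1)
    have h4 : ∫ τ in (1 - y)..1, w (y + τ) / τ ^ s = 0 := by
      refine intervalIntegral.integral_zero_ae (.of_forall fun τ hτ => ?_)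
      rw [Set.uIoc_of_le (by linarith [hy.1])] at hτ
      rw [h1 _ (by linarith [hτ.1]), zero_div]
    rw [← h2, ← h3, h4, add_zero]
  have hsh : ∀ y : ℝ, Continuous fun τ => y + τ := fun y => continuous_const.add continuous_id
  have hd := intervalIntegral.hasDerivAt_integral_of_dominated_loc_of_deriv_le
    (μ := volume) (a := 0) (b := 1) (s := Set.univ) (x₀ := x)
    (F := fun y τ => w (y + τ) / τ ^ s) (F' := fun y τ => w' (y + τ) / τ ^ s)
    (bound := fun τ => M / τ ^ s) univ_mem
    (.of_forall fun y => (intervalIntegrable_iff.1 (intervalIntegrable_div_rpow hs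
      (hwc.comp (hsh y)) zero_le_one)).aestronglyMeasurable)
    (intervalIntegrable_div_rpow hs (hwc.comp (hsh x)) zero_le_one)
    (intervalIntegrable_iff.1 (intervalIntegrable_div_rpow hs
      (hw'.comp (hsh x)) zero_le_one)).aestronglyMeasurable
    (.of_forall fun τ hτ y _ => by
      rw [Set.uIoc_of_le zero_le_one] at hτ
      have := Real.rpow_nonneg hτ.1.le s
      rw [Real.norm_eq_abs, abs_div, abs_of_nonneg this]
      exact div_le_div_of_nonneg_right (hM _) this)
    (intervalIntegrable_div_rpow hs continuous_const zero_le_one)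
    (.of_forall fun τ _ y _ => ((hw (y + τ)).comp_add_const y τ).div_const _)
  rw [rightRL, heq.deriv_eq, hd.2.deriv]

/-- The right-sided Riemann-Liouville derivative in the `i`-th variable in the form due to
Caputo. -/
def caputo (s : ℝ) (i : Fin N) (f : (Fin N → ℝ) → ℝ) (x : Fin N → ℝ) : ℝ :=
  -(1 / Real.Gamma (1 - s)) *
    ∫ τ in (0 : ℝ)..1, pderiv i f (Function.update x i (x i + τ)) / τ ^ s

theorem IsTestFun.continuous_pderiv_line {f : (Fin N → ℝ) → ℝ} (hf : IsTestFun f) (i : Fin N)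
    (x : Fin N → ℝ) (a : ℝ) :
    Continuous fun τ => FracTV.pderiv i f (Function.update x i (a + τ)) :=
  (hf.pderiv i).contDiff.continuous.comp
    (continuous_const.update i (continuous_const.add continuous_id))

theorem IsTestFun.partialRL_eq_caputo {f : (Fin N → ℝ) → ℝ} (hf : IsTestFun f) {s : ℝ}
    (hs : s < 1) (i : Fin N) {x : Fin N → ℝ} (hx : x ∈ cube N) :
    partialRL s i f x = caputo s i f x := by
  obtain ⟨ε, hε, hsupp⟩ := hf.exists_margin
  obtain ⟨M, -, hM⟩ := (hf.pderiv i).exists_bound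
  refine rightRL_eq hs (fun t => hasDerivAt_comp_update hf.differentiable i x t) ?_
    (fun t => hM _) (fun t ht => hsupp _ i ?_) (hx i (Set.mem_univ i))
  · simpa using hf.continuous_pderiv_line i x 0
  · simp only [Function.update_self]
    exact fun h => by linarith [h.2]

theorem IsTestFun.continuous_caputo {f : (Fin N → ℝ) → ℝ} (hf : IsTestFun f) {s : ℝ}
    (hs : s < 1) (i : Fin N) : Continuous (caputo s i f) := by
  obtain ⟨M, -, hM⟩ := (hf.pderiv i).exists_bound
  refine continuous_const.mul (intervalIntegral.continuous_of_dominated_interval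
    (bound := fun τ => M / τ ^ s) (fun x => ?_) (fun x => .of_forall fun τ hτ => ?_)
    (intervalIntegrable_div_rpow hs continuous_const zero_le_one) (.of_forall fun τ _ => ?_))
  · exact (intervalIntegrable_iff.1 (intervalIntegrable_div_rpow hs
      (hf.continuous_pderiv_line i x (x i)) zero_le_one)).aestronglyMeasurable
  · rw [Set.uIoc_of_le zero_le_one] at hτ
    have := Real.rpow_nonneg hτ.1.le s
    rw [Real.norm_eq_abs, abs_div, abs_of_nonneg this]
    exact div_le_div_of_nonneg_right (hM _) this
  · exact ((hf.pderiv i).contDiff.continuous.comp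
      (continuous_id.update i ((continuous_apply i).add continuous_const))).div_const _

/-- Only a bound on the derivative in direction i enters; this is why the splitting controls ∂_i R.
-/
theorem abs_caputo_le {f : (Fin N → ℝ) → ℝ} {s : ℝ} (hs : s < 1) (i : Fin N) {M : ℝ}
    (hM : ∀ x, |pderiv i f x| ≤ M) (x : Fin N → ℝ) :
    |caputo s i f x| ≤ 1 / Real.Gamma (1 - s) * ∫ τ in (0 : ℝ)..1, M / τ ^ s := by
  have hΓ : 0 < Real.Gamma (1 - s) := Real.Gamma_pos_of_pos (by linarith)
  rw [caputo, abs_mul, abs_neg, abs_of_pos (by positivity)]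
  refine mul_le_mul_of_nonneg_left ?_ (by positivity)
  rw [← Real.norm_eq_abs]
  refine intervalIntegral.norm_integral_le_of_norm_le zero_le_one (.of_forall fun τ hτ => ?_)
    (intervalIntegrable_div_rpow hs continuous_const zero_le_one)
  have := Real.rpow_nonneg hτ.1.le s
  rw [Real.norm_eq_abs, abs_div, abs_of_nonneg this]
  exact div_le_div_of_nonneg_right (hM _) this

theorem caputo_const_mul_add {f g : (Fin N → ℝ) → ℝ} (hf : IsTestFun f) (hg : IsTestFun g)
    {s : ℝ} (hs : s < 1) (i : Fin N) (c : ℝ) (x : Fin N → ℝ) :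
    caputo s i (fun y => c * f y + g y) x = c * caputo s i f x + caputo s i g x := by
  have hif := intervalIntegrable_div_rpow hs (hf.continuous_pderiv_line i x (x i)) zero_le_one
  have hig := intervalIntegrable_div_rpow hs (hg.continuous_pderiv_line i x (x i)) zero_le_one
  simp only [caputo, pderiv_add (hf.const_mul c) hg, pderiv_const_mul hf, add_div, mul_div_assoc]
  rw [intervalIntegral.integral_add (hif.const_mul c) hig, intervalIntegral.integral_const_mul]
  ring

theorem fracDiv_eq_caputo {s : ℝ} (hs : s < 1) {F : Fin N → (Fin N → ℝ) → ℝ}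
    (hF : ∀ i, IsTestFun (F i)) {x : Fin N → ℝ} (hx : x ∈ cube N) :
    fracDiv s F x = ((1 - 1 / (N : ℝ)) * s + 1 / (N : ℝ)) * ∑ i, caputo s i (F i) x := by
  simp only [fracDiv, fun i => (hF i).partialRL_eq_caputo hs i hx]

theorem measurableSet_cube : MeasurableSet (cube N) :=
  MeasurableSet.univ_pi fun _ => measurableSet_Ioo

/-- Pairing an integrable function with the fractional divergence of a field of test functions. -/
theorem integrableOn_mul_fracDiv {s : ℝ} (hs : s < 1) {F : Fin N → (Fin N → ℝ) → ℝ}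
    (hF : ∀ i, IsTestFun (F i)) {u : (Fin N → ℝ) → ℝ} (hu : IntegrableOn u (cube N)) :
    IntegrableOn (fun x => u x * fracDiv s F x) (cube N) := by
  have hb : ∀ i, ∃ M, ∀ x, |caputo s i (F i) x| ≤ M := fun i => by
    obtain ⟨M, -, hM⟩ := ((hF i).pderiv i).exists_bound
    exact ⟨_, abs_caputo_le hs i hM⟩
  choose M hM using hb
  have hi : IntegrableOn (fun x => u x *
      (((1 - 1 / (N : ℝ)) * s + 1 / (N : ℝ)) * ∑ i, caputo s i (F i) x)) (cube N) := by
    refine Integrable.mul_bdd (c := |(1 - 1 / (N : ℝ)) * s + 1 / (N : ℝ)| * ∑ i, M i) hu ?_ ?_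
    · exact (continuous_const.mul (continuous_finsetSum _
        fun i _ => (hF i).continuous_caputo hs i)).aestronglyMeasurable
    · refine .of_forall fun x => ?_
      rw [Real.norm_eq_abs, abs_mul]
      exact mul_le_mul_of_nonneg_left ((Finset.abs_sum_le_sum_abs _ _).trans
        (Finset.sum_le_sum fun i _ => hM i x)) (abs_nonneg _)
  exact hi.congr_fun (fun x hx => by simp only [fracDiv_eq_caputo hs hF hx]) measurableSet_cube

/-! ### Dual norms -/

theorem sum_mul_le_sum_abs {ι : Type} [Fintype ι] {p : ℝ≥0∞} [Fact (1 ≤ p)] (a : ι → ℝ)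
    {y : PiLp p fun _ : ι => ℝ} (hy : ‖y‖ ≤ 1) : ∑ i, a i * y i ≤ ∑ i, |a i| := by
  refine Finset.sum_le_sum fun i _ => ?_
  have h1 : |y i| ≤ 1 := (PiLp.norm_apply_le y i).trans hy
  calc a i * y i ≤ |a i| * |y i| := (le_abs_self _).trans (abs_mul _ _).le
    _ ≤ |a i| := mul_le_of_le_one_right (abs_nonneg _) h1

theorem dualNorm_le_sum_abs {ι : Type} [Fintype ι] {p : ℝ≥0∞} (hp : 1 ≤ p) (a : ι → ℝ) :
    dualNorm p a ≤ ∑ i, |a i| := by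
  have : Fact (1 ≤ p) := ⟨hp⟩
  refine csSup_le ⟨0, 0, by simp, by simp⟩ ?_
  rintro t ⟨y, hy, rfl⟩
  exact sum_mul_le_sum_abs a hy

/-- Test against plus or minus the i-th basis vector, which has norm 1 for every p. -/
theorem abs_le_dualNorm {ι : Type} [Fintype ι] {p : ℝ≥0∞} (hp : 1 ≤ p) (a : ι → ℝ) (i : ι) :
    |a i| ≤ dualNorm p a := by
  classical
  have : Fact (1 ≤ p) := ⟨hp⟩
  have hbdd : BddAbove {t : ℝ | ∃ y : PiLp p (fun _ : ι => ℝ), ‖y‖ ≤ 1 ∧ t = ∑ i, a i * y i} := by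
    refine ⟨∑ i, |a i|, ?_⟩
    rintro t ⟨y, hy, rfl⟩
    exact sum_mul_le_sum_abs a hy
  have key : ∀ σ : ℝ, |σ| ≤ 1 → a i * σ ≤ dualNorm p a := fun σ hσ => by
    refine le_csSup hbdd ⟨PiLp.single p i σ, ?_, ?_⟩
    · rwa [PiLp.norm_single, Real.norm_eq_abs]
    · simp
  rcases abs_cases (a i) with ⟨h, -⟩ | ⟨h, -⟩
  · simpa [h] using key 1 (by simp)
  · simpa [h] using key (-1) (by simp)

theorem IsTest.isTestFun {ι : Type} [Fintype ι] {p : ℝ≥0∞} {φ : ι → (Fin N → ℝ) → ℝ}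
    (h : IsTest p φ) (i : ι) : IsTestFun (φ i) :=
  ⟨(h.1 i).1, (h.1 i).2.1, (h.1 i).2.2⟩

theorem IsTest.abs_le_one {ι : Type} [Fintype ι] {p : ℝ≥0∞} (hp : 1 ≤ p)
    {φ : ι → (Fin N → ℝ) → ℝ} (h : IsTest p φ) (i : ι) (x : Fin N → ℝ) : |φ i x| ≤ 1 :=
  (abs_le_dualNorm hp (fun i => φ i x) i).trans (h.2 x)

theorem isTest_of_abs_le {ι : Type} [Fintype ι] {p : ℝ≥0∞} (hp : 1 ≤ p)
    {φ : ι → (Fin N → ℝ) → ℝ} (h : ∀ i, IsTestFun (φ i)) {c : ℝ}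
    (hc : Fintype.card ι * c ≤ 1) (hφ : ∀ i x, |φ i x| ≤ c) : IsTest p φ := by
  refine ⟨fun i => ⟨(h i).contDiff, (h i).hasCompactSupport, (h i).tsupport_subset⟩, fun x => ?_⟩
  refine (dualNorm_le_sum_abs hp _).trans ((Finset.sum_le_sum fun i _ => hφ i x).trans ?_)
  simpa using hc

/-! ### Iterated divergences of fields with a single entry -/

theorem snoc_eq_const_iff {k : ℕ} {i j : Fin N} {a : Fin k → Fin N} :
    (Fin.snoc (α := fun _ => Fin N) a j = fun _ => i) ↔ (a = fun _ => i) ∧ j = i := by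
  constructor
  · intro h
    refine ⟨funext fun l => ?_, ?_⟩
    · simpa using congrFun h l.castSucc
    · simpa using congrFun h (Fin.last k)
  · rintro ⟨rfl, rfl⟩
    ext l
    refine Fin.lastCases ?_ (fun m => ?_) l <;> simp

/-- Contracting the last index of a field supported on the constant multi-index leaves a field of
the same kind, with g replaced by ∂_i g. -/
theorem iterDiv_ite_const (i : Fin N) (k : ℕ) (g : (Fin N → ℝ) → ℝ) :
    iterDiv k (fun a => if (a = fun _ => i) then g else fun _ => 0) = (pderiv i)^[k] g := by
  induction k generalizing g with
  | zero =>
    have : (fun l : Fin 0 => (l.elim0 : Fin N)) = fun _ => i := funext fun l => l.elim0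
    simp [iterDiv, this]
  | succ k ih =>
    rw [iterDiv, Function.iterate_succ_apply, ← ih (pderiv i g)]
    congr 1
    ext a x
    simp only [snoc_eq_const_iff]
    by_cases ha : a = fun _ => i
    · simp only [ha, true_and, if_true]
      rw [Finset.sum_eq_single i]
      · simp [pderiv]
      · intro j _ hj; simp [hj]
      · simp
    · simp [ha]

/-! ### The comparison of total variations -/

theorem intTV_zero_le_normL1 {p : ℝ≥0∞} (hp : 1 ≤ p) (u : (Fin N → ℝ) → ℝ) :
    intTV p 0 u ≤ normL1 u := by
  refine iSup₂_le fun φ hφ => ?_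
  refine (ENNReal.ofReal_le_ofReal (Real.le_norm_self _)).trans ?_
  rw [ofReal_norm]
  refine (enorm_integral_le_lintegral_enorm _).trans (lintegral_mono fun x => ?_)
  rw [enorm_mul]
  refine mul_le_of_le_one_right' ?_
  rw [← ofReal_norm, Real.norm_eq_abs]
  exact ENNReal.ofReal_le_one.2 (hφ.abs_le_one hp _ x)

theorem ofReal_setIntegral_mul_le {u g : (Fin N → ℝ) → ℝ} {M : ℝ}
    (hM : ∀ x ∈ cube N, |g x| ≤ M) :
    ENNReal.ofReal (∫ x in cube N, u x * g x) ≤ ENNReal.ofReal M * normL1 u := by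
  refine (ENNReal.ofReal_le_ofReal (Real.le_norm_self _)).trans ?_
  rw [ofReal_norm, normL1, ← lintegral_const_mul' _ _ ENNReal.ofReal_ne_top]
  refine (enorm_integral_le_lintegral_enorm _).trans ?_
  refine setLIntegral_mono' measurableSet_cube fun x hx => ?_
  rw [enorm_mul, mul_comm]
  refine mul_le_mul_left ?_ _
  rw [← ofReal_norm]
  exact ENNReal.ofReal_le_ofReal (hM x hx)

theorem exists_fracTV_zero_le (N k : ℕ) {s : ℝ} (hs : s < 1) :
    ∃ C : ℝ, 0 < C ∧ ∀ p : ℝ≥0∞, 1 ≤ p → ∀ u : (Fin N → ℝ) → ℝ, IntegrableOn u (cube N) →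
      fracTV p 0 s u ≤ ENNReal.ofReal C * (normL1 u + fracTV p k s u) := by
  obtain ⟨C₀, hC₀, hsplit⟩ := exists_bound_eq_iterate_pderiv_add (N := N) k
  -- Dividing by `L` makes the ℓ^1 norm of the new field at most 1, hence also every dual norm; the
  -- summand 1 ensures positivity even without entries.
  set L : ℝ := Fintype.card (Fin N × (Fin k → Fin N)) * C₀ + 1 with hL
  set κ : ℝ := (1 - 1 / (N : ℝ)) * s + 1 / (N : ℝ) with hκ
  set M : ℝ := |κ| * ∑ _i : Fin N, 1 / Real.Gamma (1 - s) * ∫ τ in (0 : ℝ)..1, C₀ / τ ^ s with hMdef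
  have hL0 : 0 < L := by positivity
  refine ⟨max L M, lt_max_of_lt_left hL0, fun p hp u hu => iSup₂_le fun φ hφ => ?_⟩
  have hex := fun i : Fin N => hsplit i (φ (i, fun l => l.elim0)) (hφ.isTestFun _)
    (hφ.abs_le_one hp _)
  choose g R hg hR hgC hRC hφe using hex
  -- The array is nonzero only at the entries (i; i,…,i), so that its divergence in row i is L⁻¹
  -- ∂_i^k g_i.
  let Ψ : Fin N × (Fin k → Fin N) → (Fin N → ℝ) → ℝ := fun q =>
    if (q.2 = fun _ => q.1) then fun x => L⁻¹ * g q.1 x else fun _ => 0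
  have hΨ : IsTest p Ψ := by
    refine isTest_of_abs_le hp (c := L⁻¹ * C₀) (fun q => ?_) ?_ fun q x => ?_
    · by_cases hq : q.2 = fun _ => q.1
      · simpa only [Ψ, hq, if_true] using (hg q.1).const_mul _
      · simpa only [Ψ, hq, if_false] using IsTestFun.zero
    · rw [mul_left_comm, inv_mul_le_one₀ hL0]
      linarith
    · by_cases hq : q.2 = fun _ => q.1
      · simp only [Ψ, hq, if_true, abs_mul, abs_of_pos (inv_pos.2 hL0)]
        exact mul_le_mul_of_nonneg_left (hgC _ _) (inv_pos.2 hL0).le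
      · simp only [Ψ, hq, if_false, abs_zero]
        positivity
  have hdiv : ∀ i, iterDiv k (fun a => Ψ (i, a)) = fun x => L⁻¹ * (pderiv i)^[k] (g i) x := by
    intro i
    rw [← iterate_pderiv_const_mul (hg i), ← iterDiv_ite_const]
  have hdivT : ∀ i, IsTestFun (iterDiv k fun a => Ψ (i, a)) := fun i => by
    rw [hdiv]; exact ((hg i).iterate_pderiv i k).const_mul _
  have hφT : ∀ i, IsTestFun (iterDiv 0 fun a => φ (i, a)) := fun i => hφ.isTestFun _
  have hφdiv : ∀ i, (iterDiv 0 fun a => φ (i, a)) =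
      fun x => L * (iterDiv k fun a => Ψ (i, a)) x + R i x := by
    intro i
    rw [hdiv i]
    refine (hφe i).trans ?_
    ext x
    rw [mul_inv_cancel_left₀ hL0.ne']
  have hpt : ∀ x ∈ cube N, fracDiv s (fun i => iterDiv 0 fun a => φ (i, a)) x =
      L * fracDiv s (fun i => iterDiv k fun a => Ψ (i, a)) x + fracDiv s R x := by
    intro x hx
    rw [fracDiv_eq_caputo hs hφT hx, fracDiv_eq_caputo hs hdivT hx, fracDiv_eq_caputo hs hR hx]
    simp only [hφdiv, caputo_const_mul_add (hdivT _) (hR _) hs, Finset.sum_add_distrib,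
      ← Finset.mul_sum]
    ring
  have hint : ∫ x in cube N, u x * fracDiv s (fun i => iterDiv 0 fun a => φ (i, a)) x =
      L * (∫ x in cube N, u x * fracDiv s (fun i => iterDiv k fun a => Ψ (i, a)) x) +
        ∫ x in cube N, u x * fracDiv s R x := by
    rw [← integral_const_mul, ← integral_add
      ((integrableOn_mul_fracDiv hs hdivT hu).const_mul L) (integrableOn_mul_fracDiv hs hR hu)]
    refine setIntegral_congr_fun measurableSet_cube fun x hx => ?_
    simp only [hpt x hx]
    ring
  have hRM : ∀ x ∈ cube N, |fracDiv s R x| ≤ M := by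
    intro x hx
    rw [fracDiv_eq_caputo hs hR hx, abs_mul]
    exact mul_le_mul_of_nonneg_left ((Finset.abs_sum_le_sum_abs _ _).trans
      (Finset.sum_le_sum fun i _ => abs_caputo_le hs i (hRC i) x)) (abs_nonneg _)
  calc ENNReal.ofReal (∫ x in cube N, u x * fracDiv s (fun i => iterDiv 0 fun a => φ (i, a)) x)
      ≤ ENNReal.ofReal
          (L * ∫ x in cube N, u x * fracDiv s (fun i => iterDiv k fun a => Ψ (i, a)) x) +
          ENNReal.ofReal (∫ x in cube N, u x * fracDiv s R x) := by
        rw [hint]; exact ENNReal.ofReal_add_le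
    _ ≤ ENNReal.ofReal L * fracTV p k s u + ENNReal.ofReal M * normL1 u := by
        refine add_le_add ?_ (ofReal_setIntegral_mul_le hRM)
        rw [ENNReal.ofReal_mul hL0.le]
        exact mul_le_mul_right (le_iSup₂ (f := fun (φ : Fin N × (Fin k → Fin N) → (Fin N → ℝ) → ℝ)
          (_ : IsTest p φ) => ENNReal.ofReal
            (∫ x in cube N, u x * fracDiv s (fun i => iterDiv k fun a => φ (i, a)) x)) Ψ hΨ) _
    _ ≤ ENNReal.ofReal (max L M) * fracTV p k s u + ENNReal.ofReal (max L M) * normL1 u := by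
        gcongr
        · exact le_max_left _ _
        · exact le_max_right _ _
    _ = ENNReal.ofReal (max L M) * (normL1 u + fracTV p k s u) := by
        rw [mul_add, add_comm]

theorem SV.integrableOn {r : ℝ} {u : (Fin N → ℝ) → ℝ} (hu : u ∈ SV N r) :
    IntegrableOn u (cube N) := by
  obtain ⟨v, -, hv⟩ := hu 1 le_rfl
  exact hv.integrable_lim

end FracTV
end

theorem theorem4p7 (N : ℕ) (hN : 1 ≤ N) (r : ℝ) (hr : 0 < r) :
    ∃ C : ℝ, 0 < C ∧ ∀ (p : ENNReal), 1 ≤ p → ∀ u : (Fin N → ℝ) → ℝ, u ∈ FracTV.SV N r →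
      FracTV.TV p (Int.fract r) u ≤
        ENNReal.ofReal C * (FracTV.normL1 u + FracTV.TV p r u) := by
  have hfl : ⌊Int.fract r⌋₊ = 0 := Nat.floor_eq_zero.2 (Int.fract_lt_one r)
  by_cases h0 : Int.fract r = 0
  -- For integer r the left side is the variation of order 0, at most the L^1 norm.
  · refine ⟨1, one_pos, fun p hp u _ => ?_⟩
    rw [FracTV.TV, Int.fract_fract, if_pos h0, hfl, ENNReal.ofReal_one, one_mul]
    exact (FracTV.intTV_zero_le_normL1 hp u).trans le_self_add
  · obtain ⟨C, hC, h⟩ := FracTV.exists_fracTV_zero_le N ⌊r⌋₊ (Int.fract_lt_one r)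
    refine ⟨C, hC, fun p hp u hu => ?_⟩
    rw [FracTV.TV, FracTV.TV, Int.fract_fract, if_neg h0, if_neg h0, hfl]
    exact h p hp u (FracTV.SV.integrableOn hu)
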